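/- Let $X$ be a finite set and let $X^*$ be the rooted tree of finite words over $X$: the root is the empty word $\varnothing$, and a word $v$ is connected by an edge to each word $vx$, $x\in X$. Let $\mathrm{Aut}(X^*)$ be the group of automorphisms of the tree $X^*$ that fix the root. For $g\in\mathrm{Aut}(X^*)$ and $v\in X^*$ let $g|_v\in\mathrm{Aut}(X^*)$ be the unique automorphism such that $g(vu)=g(v)\,g|_v(u)$ for all $u\in X^*$. A subgroup $G\le\mathrm{Aut}(X^*)$ is called self-similar if $g|_v\in G$ for all $g\in G$ and $v\in X^*$. A self-similar group $G$ is called contracting if there is a finite set $\mathcal N\subset G$ such that for every $g\in G$ there exists $n$ such that $g|_v\in\mathcal N$ for all words $v\in X^*$ of length more than $n$. **Theorem.** If $G\le\mathrm{Aut}(X^*)$ is a contracting self-similar group (not necessarily finitely generated), then $G$ has no free non-abelian subgroups. -/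

import Mathlib

/-- The tree `X*` of finite words over the alphabet `X`: a word `u` is connected with the words
`ux`, for `x` a letter. The root is the empty word `[]`. -/
def wordTree (X : Type*) : SimpleGraph (List X) where
  Adj u v := (∃ x, v = u ++ [x]) ∨ (∃ x, u = v ++ [x])
  symm := ⟨fun _ _ h => h.symm⟩
  loopless := ⟨by
    rintro u (⟨x, hx⟩ | ⟨x, hx⟩) <;> simpa using congrArg List.length hx⟩

/-- The group `Aut X*` of automorphisms of the rooted tree `X*`: the automorphisms of the graph
`X*` that fix the root. The product is composition. -/
def TreeAut (X : Type*) : Subgroup (wordTree X ≃g wordTree X) where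
  carrier := {g | g [] = []}
  mul_mem' {g h} hg hh := by
    change g (h []) = []
    rw [show h [] = [] from hh]
    exact hg
  one_mem' := rfl
  inv_mem' {g} hg := by
    change g.symm [] = []
    rw [RelIso.symm_apply_eq]
    exact Eq.symm hg

namespace TreeAut

variable {X : Type*}

instance : CoeFun (TreeAut X) (fun _ => List X → List X) := ⟨fun g => g.1⟩

theorem map_nil (g : TreeAut X) : g [] = [] := g.2

theorem inv_apply_self (g : TreeAut X) (v : List X) : g⁻¹ (g v) = v :=
  g.1.symm_apply_apply v

theorem apply_inv_self (g : TreeAut X) (v : List X) : g (g⁻¹ v) = v :=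
  g.1.apply_symm_apply v

theorem ext_apply {g h : TreeAut X} (H : ∀ v, g v = h v) : g = h :=
  Subtype.ext (RelIso.ext H)

/-- Automorphisms of the rooted tree preserve its levels. -/
theorem length_apply (g : TreeAut X) (v : List X) : (g v).length = v.length := by
  have key : ∀ n : ℕ, ∀ (g : TreeAut X) (v : List X), v.length = n → (g v).length = n := by
    intro n
    induction n using Nat.strong_induction_on with
    | _ n ih =>
      intro g v hv
      rcases List.eq_nil_or_concat v with rfl | ⟨u, x, rfl⟩
      · rw [map_nil]; exact hv
      · have hn : u.length + 1 = n := by simpa using hv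
        have hu : (g u).length = u.length := ih u.length (by omega) g u rfl
        have hadj : (wordTree X).Adj (g u) (g (u ++ [x])) :=
          g.1.map_rel_iff.2 (Or.inl ⟨x, rfl⟩)
        rcases hadj with ⟨y, hy⟩ | ⟨y, hy⟩
        · rw [List.concat_eq_append, hy]; simp [hu, hn]
        · have h1 : (g u).length = (g (u ++ [x])).length + 1 := by
            rw [hy]; simp
          have h2 := ih (g (u ++ [x])).length (by omega) g⁻¹ _ rfl
          rw [inv_apply_self] at h2
          simp at h2
          omega
  exact key _ g v rfl

theorem apply_append_singleton (g : TreeAut X) (v : List X) (x : X) :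
    ∃ y, g (v ++ [x]) = g v ++ [y] := by
  have hadj : (wordTree X).Adj (g v) (g (v ++ [x])) := g.1.map_rel_iff.2 (Or.inl ⟨x, rfl⟩)
  rcases hadj with h | ⟨y, hy⟩
  · exact h
  · have := congrArg List.length hy
    simp [length_apply] at this
    omega

theorem prefix_apply_append (g : TreeAut X) (v u : List X) : g v <+: g (v ++ u) := by
  induction u using List.reverseRecOn with
  | nil => simp
  | append_singleton u x ih =>
    obtain ⟨y, hy⟩ := apply_append_singleton g (v ++ u) x
    rw [← List.append_assoc, hy]
    exact ih.trans (List.prefix_append _ _)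

theorem apply_append_drop (g : TreeAut X) (v u : List X) :
    g v ++ (g (v ++ u)).drop v.length = g (v ++ u) := by
  obtain ⟨t, ht⟩ := prefix_apply_append g v u
  rw [← ht, ← length_apply g v, List.drop_left]

theorem adj_append_iff (v u u' : List X) :
    (wordTree X).Adj (v ++ u) (v ++ u') ↔ (wordTree X).Adj u u' := by
  simp [wordTree, List.append_assoc]

/-- The restriction `g|_v` of an automorphism `g` of `X*` at a word `v`: it is the unique
automorphism with `g (vu) = g(v) g|_v(u)` for all words `u`
(see `apply_append` and `eq_restrict`). -/
def restrict (g : TreeAut X) (v : List X) : TreeAut X where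
  val :=
    { toFun := fun u => (g (v ++ u)).drop v.length
      invFun := fun u => (g⁻¹ (g v ++ u)).drop v.length
      left_inv := fun u => by
        change (g⁻¹ (g v ++ (g (v ++ u)).drop v.length)).drop v.length = u
        rw [apply_append_drop, inv_apply_self, List.drop_left]
      right_inv := fun u => by
        change (g (v ++ (g⁻¹ (g v ++ u)).drop v.length)).drop v.length = u
        have h := apply_append_drop g⁻¹ (g v) u
        rw [inv_apply_self, length_apply] at h
        rw [h, apply_inv_self, ← length_apply g v, List.drop_left]
      map_rel_iff' := fun {u u'} => by
        change (wordTree X).Adj ((g (v ++ u)).drop v.length) ((g (v ++ u')).drop v.length) ↔ _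
        rw [← adj_append_iff (g v), apply_append_drop, apply_append_drop, g.1.map_rel_iff,
          adj_append_iff] }
  property := by
    change (g (v ++ [])).drop v.length = []
    rw [List.append_nil, ← length_apply g v, List.drop_length]

/-- The defining property of the restriction. -/
theorem apply_append (g : TreeAut X) (v u : List X) :
    g (v ++ u) = g v ++ TreeAut.restrict g v u :=
  (apply_append_drop g v u).symm

/-- The restriction is determined by its defining property. -/
theorem eq_restrict (g h : TreeAut X) (v : List X) (H : ∀ u, g (v ++ u) = g v ++ h u) :
    h = TreeAut.restrict g v :=
  ext_apply fun u => List.append_cancel_left ((H u).symm.trans (apply_append g v u))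

end TreeAut

/-- A group `G` of automorphisms of `X*` is self-similar if `g|_v ∈ G` for all `g ∈ G` and
all words `v`. -/
def IsSelfSimilar {X : Type*} (G : Subgroup (TreeAut X)) : Prop :=
  ∀ g ∈ G, ∀ v : List X, TreeAut.restrict g v ∈ G

/-- A self-similar group `G` of automorphisms of `X*` is contracting if there is a finite set
`N ⊆ G` such that for every `g ∈ G` there is `n` with `g|_v ∈ N` for all words `v` of length
more than `n`. -/
def IsContracting {X : Type*} (G : Subgroup (TreeAut X)) : Prop :=
  IsSelfSimilar G ∧
    ∃ N : Set (TreeAut X), N.Finite ∧ N ⊆ (G : Set (TreeAut X)) ∧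
      ∀ g ∈ G, ∃ n : ℕ, ∀ v : List X, n < v.length → TreeAut.restrict g v ∈ N

/-!
Suppose that `H` is a free non-abelian subgroup of the contracting group `G`.

*Small supports.* Choose `a, b ∈ H` that generate a free monoid, let `N` be the finite set into which
the restrictions of elements of `G` contract, and put `A = N ∪ {a, b}`. There is `k` such that the
restriction of a product of two elements of `A` at any word of length `k` lies in `A`. By repeated
doubling, a product of `2 ^ m` elements of `A` restricts into `A` at all words of length `k * m`
(`TreeAut.restrict_list_prod_mem`). So for a word `v` of length `k * m` the pair `(g v, g|_v)` takes
at most `|X| ^ (k * m) * |A|` values as `g` runs through the `2 ^ (2 ^ m)` products of `2 ^ m` factors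
`a`, `b`. For large `m` two products `g ≠ h` give the same pair, and `g⁻¹ * h` is a nontrivial
element of `H` that acts trivially on the subtree of `v`
(`TreeAut.exists_ne_one_restrict_eq_one`). The level `k * m` does not depend on `v`.

*Gluing.* A common power of all elements of `Aut X*` fixes this level pointwise, and free groups are
torsion free, so the elements found for the different `v` may be taken in the stabilizer of the
level. Restriction at `v` is a homomorphism on the stabilizer, so a commutator of
an element trivial on the subtrees of a set `S` of words with one trivial on the subtree of `w` is
trivial on the subtrees of `S ∪ {w}`. In a non-abelian free group any two nontrivial elements
stop commuting after one of them is conjugated by a suitable `p`-th power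
(`IsFreeGroup.exists_not_commute_conj_pow`), so these commutators can be kept nontrivial. In the end a
nontrivial element of `H` acts trivially on all of `X*`, which is absurd.

The facts on free groups come from the Nielsen–Schreier theorem (commutative subgroups are cyclic) and
the uniqueness of roots.
-/

/-! ### Commutation in free groups -/

theorem IsFreeGroup.isMulTorsionFree (F : Type*) [Group F] [IsFreeGroup F] :
    IsMulTorsionFree F :=
  (IsFreeGroup.toFreeGroup F).injective.isMulTorsionFree (IsFreeGroup.toFreeGroup F).toMonoidHom

/-- A free group is cyclic, or it contains a free monoid of rank two. -/
theorem IsFreeGroup.exists_zpow_or_exists_injective_prod (F : Type*) [Group F] [IsFreeGroup F] :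
    (∃ c : F, ∀ x : F, ∃ n : ℤ, c ^ n = x) ∨
      ∃ f : Bool → F, Function.Injective fun l : List Bool => (l.map f).prod := by
  let e := IsFreeGroup.toFreeGroup F
  rcases subsingleton_or_nontrivial (IsFreeGroup.Generators F) with hs | ⟨i, j, hij⟩
  · left
    obtain ⟨c, hc⟩ : ∃ c : FreeGroup (IsFreeGroup.Generators F),
        Set.range FreeGroup.of ⊆ ({c} : Set (FreeGroup (IsFreeGroup.Generators F))) := by
      rcases isEmpty_or_nonempty (IsFreeGroup.Generators F) with h | ⟨⟨i⟩⟩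
      · exact ⟨1, by rintro _ ⟨j, rfl⟩; exact h.elim j⟩
      · exact ⟨FreeGroup.of i, by rintro _ ⟨j, rfl⟩; rw [Subsingleton.elim j i]; rfl⟩
    refine ⟨e.symm c, fun x => ?_⟩
    have hx : e x ∈ Subgroup.closure ({c} : Set (FreeGroup (IsFreeGroup.Generators F))) := by
      refine Subgroup.closure_mono hc ?_
      rw [FreeGroup.closure_range_of]
      trivial
    obtain ⟨n, hn⟩ := Subgroup.mem_closure_singleton.1 hx
    exact ⟨n, by rw [← map_zpow, hn, MulEquiv.symm_apply_apply]⟩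
  · right
    let s : Bool → IsFreeGroup.Generators F := fun t => cond t i j
    have hs : Function.Injective s := by
      intro t t' h
      cases t <;> cases t' <;> simp_all [s]
    refine ⟨fun t => e.symm (FreeGroup.of (s t)), fun l l' hl => ?_⟩
    have key : ∀ l : List Bool, (l.map fun t => e.symm (FreeGroup.of (s t))).prod =
        e.symm (FreeGroup.mk (l.map fun t => (s t, true))) := by
      intro l
      induction l with
      | nil => simp [← FreeGroup.one_eq_mk]
      | cons t l ih =>
        rw [List.map_cons, List.prod_cons, ih, ← map_mul, FreeGroup.of, FreeGroup.mul_mk]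
        rfl
    -- words in positive letters are reduced
    have hred : ∀ l : List Bool, FreeGroup.IsReduced (l.map fun t => (s t, true)) := by
      intro l
      unfold FreeGroup.IsReduced
      rw [List.isChain_map]
      exact (List.pairwise_of_forall fun _ _ _ => rfl).isChain
    simp only [key] at hl
    classical
    have h := congrArg FreeGroup.toWord (e.symm.injective hl)
    simp only [FreeGroup.toWord_mk, (hred _).reduce_eq] at h
    exact List.map_injective_iff.2 (fun t t' ht => hs (Prod.ext_iff.1 ht).1) h

theorem IsFreeGroup.exists_zpow_of_commute {F : Type*} [Group F] [IsFreeGroup F]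
    (h : ∀ x y : F, Commute x y) : ∃ c : F, ∀ x : F, ∃ n : ℤ, c ^ n = x := by
  refine (exists_zpow_or_exists_injective_prod F).resolve_right ?_
  rintro ⟨f, hf⟩
  have := @hf [true, false] [false, true] (by simpa using (h (f true) (f false)).eq)
  simp at this

theorem IsFreeGroup.exists_injective_prod {F : Type*} [Group F] [IsFreeGroup F]
    (h : ∃ a b : F, ¬ Commute a b) :
    ∃ f : Bool → F, Function.Injective fun l : List Bool => (l.map f).prod := by
  refine (exists_zpow_or_exists_injective_prod F).resolve_left ?_
  rintro ⟨c, hc⟩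
  obtain ⟨a, b, hab⟩ := h
  obtain ⟨m, rfl⟩ := hc a
  obtain ⟨n, rfl⟩ := hc b
  exact hab (Commute.zpow_zpow_self c m n)

theorem Commute.of_zpow_left {F : Type*} [Group F] [IsMulTorsionFree F] {x z : F} {i : ℤ}
    (hi : i ≠ 0) (h : Commute (x ^ i) z) : Commute x z := by
  have h1 : (z * x * z⁻¹) ^ i = x ^ i := by
    rw [conj_zpow, ← h.eq, mul_inv_cancel_right]
  have h2 : z * x * z⁻¹ = x := zpow_left_injective hi h1
  exact (mul_inv_eq_iff_eq_mul.1 h2).symm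

/-- Nontrivial elements of a free group that commute have a common nontrivial power. -/
theorem IsFreeGroup.exists_zpow_eq_zpow {F : Type*} [Group F] [IsFreeGroup F] {x y : F}
    (hx : x ≠ 1) (hy : y ≠ 1) (h : Commute x y) : ∃ i j : ℤ, i ≠ 0 ∧ j ≠ 0 ∧ x ^ i = y ^ j := by
  let K := Subgroup.closure ({x, y} : Set F)
  have hK : ∀ u v : K, Commute u v := by
    have := Subgroup.isMulCommutative_closure (k := ({x, y} : Set F)) (by
      rintro u (rfl | rfl) v (rfl | rfl)
      exacts [rfl, h, h.symm, rfl])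
    exact fun u v => mul_comm' u v
  obtain ⟨c, hc⟩ := IsFreeGroup.exists_zpow_of_commute hK
  obtain ⟨m, hm⟩ := hc ⟨x, Subgroup.subset_closure (by simp)⟩
  obtain ⟨n, hn⟩ := hc ⟨y, Subgroup.subset_closure (by simp)⟩
  replace hm : (c : F) ^ m = x := by simpa using congrArg Subtype.val hm
  replace hn : (c : F) ^ n = y := by simpa using congrArg Subtype.val hn
  refine ⟨n, m, ?_, ?_, ?_⟩
  · rintro rfl
    exact hy (by rw [← hn, zpow_zero])
  · rintro rfl
    exact hx (by rw [← hm, zpow_zero])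
  · rw [← hm, ← hn, ← zpow_mul, ← zpow_mul, mul_comm]

/-- Free groups are commutative transitive. -/
theorem IsFreeGroup.commute_trans {F : Type*} [Group F] [IsFreeGroup F] {x y z : F}
    (hy : y ≠ 1) (h : Commute x y) (h' : Commute y z) : Commute x z := by
  have := IsFreeGroup.isMulTorsionFree F
  rcases eq_or_ne x 1 with rfl | hx
  · exact Commute.one_left z
  · obtain ⟨i, j, hi, -, hij⟩ := exists_zpow_eq_zpow hx hy h
    exact Commute.of_zpow_left hi (hij ▸ h'.zpow_left j)

/-- If the conjugates of `y` by all powers of `t` commute with each other, then `t` commutes with `y`: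
these conjugates generate a cyclic group, on which `t` acts by `c ↦ c` or `c ↦ c⁻¹`. -/
theorem IsFreeGroup.commute_of_commute_conj {F : Type*} [Group F] [IsFreeGroup F] {t y : F}
    (h : ∀ k l : ℤ, Commute (t ^ k * y * (t ^ k)⁻¹) (t ^ l * y * (t ^ l)⁻¹)) : Commute t y := by
  have := IsFreeGroup.isMulTorsionFree F
  let K := Subgroup.closure (Set.range fun k : ℤ => t ^ k * y * (t ^ k)⁻¹)
  have hK : ∀ u v : K, Commute u v := by
    have := Subgroup.isMulCommutative_closure (k := Set.range fun k : ℤ => t ^ k * y * (t ^ k)⁻¹)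
      (by rintro _ ⟨k, rfl⟩ _ ⟨l, rfl⟩; exact h k l)
    exact fun u v => mul_comm' u v
  have hconj : ∀ (r : ℤ) (u : F), u ∈ K → t ^ r * u * (t ^ r)⁻¹ ∈ K := by
    intro r u hu
    have hle : K ≤ K.comap (MulAut.conj (t ^ r)).toMonoidHom := by
      refine (Subgroup.closure_le _).2 ?_
      rintro _ ⟨k, rfl⟩
      refine Subgroup.subset_closure ⟨r + k, ?_⟩
      change t ^ (r + k) * y * (t ^ (r + k))⁻¹ = t ^ r * (t ^ k * y * (t ^ k)⁻¹) * (t ^ r)⁻¹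
      group
    exact hle hu
  obtain ⟨c, hc⟩ := IsFreeGroup.exists_zpow_of_commute hK
  have hcK : ∀ u ∈ K, ∃ n : ℤ, (c : F) ^ n = u := fun u hu => by
    obtain ⟨n, hn⟩ := hc ⟨u, hu⟩
    exact ⟨n, by simpa using congrArg Subtype.val hn⟩
  have hyK : y ∈ K := Subgroup.subset_closure ⟨0, by simp⟩
  obtain ⟨n, hn⟩ := hcK _ (hconj 1 c c.2)
  obtain ⟨m, hm⟩ := hcK _ (hconj (-1) c c.2)
  obtain ⟨q, hq⟩ := hcK y hyK
  rw [zpow_one] at hn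
  rw [zpow_neg_one, inv_inv] at hm
  have hct : Commute t (c : F) := by
    by_cases hc1 : (c : F) = 1
    · rw [hc1]
      exact Commute.one_right t
    · have hnm : (c : F) ^ (n * m) = (c : F) ^ (1 : ℤ) := by
        rw [zpow_mul, hn, conj_zpow, hm]
        group
      have hnm1 : n * m = 1 := 
        injective_zpow_iff_not_isOfFinOrder.2 (not_isOfFinOrder_of_isMulTorsionFree hc1) hnm
      -- `n = ±1`, so `t ^ 2` centralizes `c`
      have hnn : n * n = 1 := by
        rcases Int.eq_one_or_neg_one_of_mul_eq_one hnm1 with rfl | rfl <;> rfl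
      have h2 : t * (t * c * t⁻¹) * t⁻¹ = c := by
        rw [← hn, ← conj_zpow, ← hn, ← zpow_mul, hnn, zpow_one]
      refine Commute.of_zpow_left (i := 2) two_ne_zero ?_
      change t ^ (2 : ℤ) * c = c * t ^ (2 : ℤ)
      rw [← mul_assoc, mul_inv_eq_iff_eq_mul, ← mul_assoc, mul_inv_eq_iff_eq_mul] at h2
      rw [zpow_two, mul_assoc, ← mul_assoc, h2, mul_assoc]
  rw [← hq]
  exact hct.zpow_right q

theorem IsFreeGroup.exists_not_commute_conj_pow {F : Type*} [Group F] [IsFreeGroup F]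
    (hF : ∃ a b : F, ¬ Commute a b) {x y : F} (hx : x ≠ 1) (hy : y ≠ 1) {p : ℕ} (hp : p ≠ 0) :
    ∃ g : F, ¬ Commute x (g ^ p * y * (g ^ p)⁻¹) := by
  have := IsFreeGroup.isMulTorsionFree F
  by_contra! h
  have hcomm : ∀ g : F, Commute g y := by
    intro g
    have hx' : ∀ k : ℤ, Commute x ((g ^ p) ^ k * y * ((g ^ p) ^ k)⁻¹) := fun k => by
      rw [← zpow_natCast g, ← zpow_mul, mul_comm (p : ℤ), zpow_mul, zpow_natCast]
      exact h (g ^ k)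
    have hg : Commute (g ^ p) y :=
      commute_of_commute_conj fun k l => commute_trans hx (hx' k).symm (hx' l)
    refine Commute.of_zpow_left (i := p) (by exact_mod_cast hp) ?_
    rwa [zpow_natCast]
  obtain ⟨a, b, hab⟩ := hF
  exact hab (commute_trans hy (hcomm a) (hcomm b).symm)

/-! ### Restrictions of tree automorphisms -/

namespace TreeAut

variable {X : Type*}

theorem one_apply (v : List X) : (1 : TreeAut X) v = v := rfl

theorem mul_apply (g h : TreeAut X) (v : List X) : (g * h) v = g (h v) := rfl

theorem restrict_one (v : List X) : restrict (1 : TreeAut X) v = 1 :=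
  (eq_restrict 1 1 v fun _ => rfl).symm

theorem restrict_mul (g h : TreeAut X) (v : List X) :
    restrict (g * h) v = restrict g (h v) * restrict h v :=
  (eq_restrict _ _ _ fun u => by
    rw [mul_apply, mul_apply, mul_apply, apply_append, apply_append]).symm

theorem restrict_append (g : TreeAut X) (v w : List X) :
    restrict g (v ++ w) = restrict (restrict g v) w :=
  (eq_restrict _ _ _ fun u => by
    rw [List.append_assoc, apply_append, apply_append, apply_append g v w,
      List.append_assoc]).symm

/-- The subgroup of the automorphisms that fix the word `v` and all words of the subtree below
it. -/
def subtreeFixer (v : List X) : Subgroup (TreeAut X) where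
  carrier := {g | g v = v ∧ restrict g v = 1}
  one_mem' := ⟨rfl, restrict_one v⟩
  mul_mem' {g h} hg hh := by
    refine ⟨by rw [mul_apply, hh.1, hg.1], ?_⟩
    rw [restrict_mul, hh.1, hg.2, hh.2, one_mul]
  inv_mem' {g} hg := by
    have h1 : g⁻¹ v = v := by
      conv_lhs => rw [← hg.1]
      exact inv_apply_self g v
    refine ⟨h1, ?_⟩
    have h2 := restrict_mul g g⁻¹ v
    rwa [mul_inv_cancel, restrict_one, h1, hg.2, one_mul, eq_comm] at h2

theorem conj_mem_subtreeFixer {g h : TreeAut X} {v : List X} (hg : g ∈ subtreeFixer v)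
    (hh : h v = v) : h * g * h⁻¹ ∈ subtreeFixer v := by
  have h1 : h⁻¹ v = v := by
    conv_lhs => rw [← hh]
    exact inv_apply_self h v
  refine ⟨by rw [mul_apply, mul_apply, h1, hg.1, hh], ?_⟩
  rw [restrict_mul, restrict_mul, h1, hg.1, hg.2, mul_one]
  have h2 := restrict_mul h h⁻¹ v
  rwa [mul_inv_cancel, restrict_one, h1, eq_comm] at h2

/-- Two automorphisms with the same image of `v` and the same restriction at `v` differ by an
automorphism that is trivial on the subtree of `v`. -/
theorem inv_mul_mem_subtreeFixer {g h : TreeAut X} {v : List X} (h1 : g v = h v)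
    (h2 : restrict g v = restrict h v) : g⁻¹ * h ∈ subtreeFixer v := by
  refine ⟨by rw [mul_apply, ← h1, inv_apply_self], ?_⟩
  rw [restrict_mul, ← h1, ← h2, ← restrict_mul, inv_mul_cancel, restrict_one]

/-- An automorphism that is trivial on the subtree of each word of some level is trivial. -/
theorem eq_one_of_forall_mem_subtreeFixer {g : TreeAut X} {n : ℕ}
    (h : ∀ v : List X, v.length = n → g ∈ subtreeFixer v) : g = 1 := by
  have hlong : ∀ u : List X, n ≤ u.length → g u = u := fun u hu => by
    have hv := h (u.take n) (by simpa using hu)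
    conv_lhs => rw [← List.take_append_drop n u]
    rw [apply_append, hv.1, hv.2, one_apply, List.take_append_drop]
  refine ext_apply fun u => ?_
  rw [one_apply]
  rcases u with _ | ⟨x, u⟩
  · exact map_nil g
  · obtain ⟨t, ht⟩ := prefix_apply_append g (x :: u) (List.replicate n x)
    rw [hlong (x :: u ++ List.replicate n x) (by simp; omega)] at ht
    exact (List.append_inj ht (length_apply g _)).1

/-- Some power fixes a given level of the tree, uniformly in the automorphism. -/
theorem exists_pow_fix_level [Finite X] (n : ℕ) :
    ∃ p : ℕ, p ≠ 0 ∧ ∀ (g : TreeAut X) (v : List X), v.length = n → (g ^ p) v = v := by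
  let act : MulAction (TreeAut X) {v : List X // v.length = n} :=
    { smul := fun g v => ⟨g v.1, (length_apply g v.1).trans v.2⟩
      one_smul := fun _ => rfl
      mul_smul := fun _ _ _ => rfl }
  have : Finite {v : List X // v.length = n} := List.finite_length_eq X n
  refine ⟨Nat.card (Equiv.Perm {v : List X // v.length = n}), Nat.card_pos.ne',
    fun g v hv => ?_⟩
  have h : MulAction.toPermHom (TreeAut X) {v : List X // v.length = n}
      (g ^ Nat.card (Equiv.Perm {v : List X // v.length = n})) = 1 := by
    rw [map_pow, pow_card_eq_one']
  exact congrArg Subtype.val (Equiv.congr_fun h ⟨v, hv⟩)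

/-! ### Counting restrictions in a contracting group -/

/-- If products of two elements of `A` restrict into `A` at the level `k`, then products of `2 ^ m`
elements of `A` restrict into `A` at the level `k * m`. -/
theorem restrict_list_prod_mem {A : Set (TreeAut X)} {k : ℕ}
    (hA : ∀ s ∈ A, ∀ t ∈ A, ∀ v : List X, v.length = k → restrict (s * t) v ∈ A) (m : ℕ) :
    ∀ l : List (TreeAut X), l.length = 2 ^ m → (∀ s ∈ l, s ∈ A) →
      ∀ v : List X, v.length = k * m → restrict l.prod v ∈ A := by
  induction m with
  | zero =>
    intro l hl hlA v hv
    obtain ⟨s, rfl⟩ := List.length_eq_one_iff.1 hl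
    obtain rfl : v = [] := List.length_eq_zero_iff.1 hv
    have hs : restrict s [] = s := (eq_restrict s s [] fun u => by rw [map_nil]; rfl).symm
    simpa [hs] using hlA
  | succ m ih =>
    intro l hl hlA v hv
    rw [pow_succ] at hl
    rw [← List.take_append_drop (k * m) v, restrict_append, ← List.take_append_drop (2 ^ m) l,
      List.prod_append, restrict_mul]
    have hv1 : (v.take (k * m)).length = k * m := by
      rw [List.length_take, hv, mul_add]
      omega
    refine hA _ (ih _ ?_ ?_ _ ?_) _ (ih _ ?_ ?_ _ hv1) _ ?_
    · rw [List.length_take]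
      omega
    · exact fun s hs => hlA s (List.mem_of_mem_take hs)
    · rw [length_apply, hv1]
    · rw [List.length_drop]
      omega
    · exact fun s hs => hlA s (List.mem_of_mem_drop hs)
    · rw [List.length_drop, hv, mul_add]
      omega

/-- For a finite subset of a contracting group, the level needed in `restrict_list_prod_mem` can be
reached after adding finitely many elements. -/
theorem exists_finite_restrict_mul_mem {G : Subgroup (TreeAut X)} (hG : IsContracting G)
    {S : Set (TreeAut X)} (hS : S.Finite) (hSG : S ⊆ G) :
    ∃ (A : Set (TreeAut X)) (k : ℕ), A.Finite ∧ S ⊆ A ∧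
      ∀ s ∈ A, ∀ t ∈ A, ∀ v : List X, v.length = k → restrict (s * t) v ∈ A := by
  obtain ⟨-, N, hN, hNG, hc⟩ := hG
  have hA : (N ∪ S).Finite := hN.union hS
  have hAG : N ∪ S ⊆ (G : Set (TreeAut X)) := Set.union_subset hNG hSG
  choose! d hd using hc
  obtain ⟨k, hk⟩ := ((hA.mul hA).image d).bddAbove
  refine ⟨N ∪ S, k + 1, hA, Set.subset_union_right, fun s hs t ht v hv => Or.inl ?_⟩
  refine hd _ (G.mul_mem (hAG hs) (hAG ht)) v ?_
  have := hk (Set.mem_image_of_mem d (Set.mul_mem_mul hs ht))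
  omega

theorem exists_pow_mul_lt_two_pow_two_pow (q k c : ℕ) : ∃ m : ℕ, q ^ (k * m) * c < 2 ^ 2 ^ m := by
  let t := 2 * (q * k) + c
  have hexp : q * (k * (2 * t)) + c < 2 ^ (2 * t) := by
    have h1 : t + 1 ≤ 2 ^ t := Nat.lt_two_pow_self
    have h2 : (t + 1) * (t + 1) ≤ 2 ^ (2 * t) := by
      rw [two_mul, pow_add]
      exact Nat.mul_le_mul h1 h1
    have h3 : q * (k * (2 * t)) + c + 1 ≤ (t + 1) * (t + 1) := by
      have h4 : 2 * (q * k) * t ≤ t * t := Nat.mul_le_mul_right t (Nat.le_add_right _ _)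
      have h5 : c ≤ t := Nat.le_add_left _ _
      nlinarith
    omega
  refine ⟨2 * t, ?_⟩
  calc q ^ (k * (2 * t)) * c ≤ (2 ^ q) ^ (k * (2 * t)) * 2 ^ c :=
        Nat.mul_le_mul (Nat.pow_le_pow_left Nat.lt_two_pow_self.le _) Nat.lt_two_pow_self.le
    _ = 2 ^ (q * (k * (2 * t)) + c) := by rw [← pow_mul, pow_add]
    _ < 2 ^ 2 ^ (2 * t) := Nat.pow_lt_pow_right one_lt_two hexp

/-- A subgroup of a contracting group that contains a free monoid of rank two has, for some level,
a nontrivial element acting trivially on the subtree of `v`, for every word `v` of this level. -/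
theorem exists_ne_one_restrict_eq_one [Finite X] {G H : Subgroup (TreeAut X)}
    (hG : IsContracting G) (hHG : H ≤ G) (f : Bool → H)
    (hf : Function.Injective fun l : List Bool => (l.map f).prod) :
    ∃ n : ℕ, ∀ v : List X, v.length = n → ∃ g : H, g ≠ 1 ∧ (g : TreeAut X) ∈ subtreeFixer v := by
  obtain ⟨A, k, hAfin, hfA, hA⟩ := exists_finite_restrict_mul_mem hG
    (S := Set.range fun t => (f t : TreeAut X)) (Set.finite_range _)
    (by rintro _ ⟨t, rfl⟩; exact hHG (f t).2)
  obtain ⟨m, hm⟩ := exists_pow_mul_lt_two_pow_two_pow (Nat.card X) k (Nat.card A)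
  refine ⟨k * m, fun v hv => ?_⟩
  have := Fintype.ofFinite X
  have : Finite A := hAfin
  have := Fintype.ofFinite A
  have hres : ∀ l : List.Vector Bool (2 ^ m),
      restrict ((l.1.map f).prod : H).1 v ∈ A := by
    intro l
    rw [Subgroup.val_list_prod, List.map_map]
    refine restrict_list_prod_mem hA m _ (by simp) ?_ v hv
    intro s hs
    obtain ⟨t, -, rfl⟩ := List.mem_map.1 hs
    exact hfA ⟨t, rfl⟩
  let Φ : List.Vector Bool (2 ^ m) → List.Vector X (k * m) × A := fun l =>
    (⟨((l.1.map f).prod : H).1 v, (length_apply _ v).trans hv⟩, ⟨_, hres l⟩)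
  obtain ⟨l, l', hne, hl⟩ := Fintype.exists_ne_map_eq_of_card_lt Φ (by
    simpa [card_vector, Fintype.card_prod, Nat.card_eq_fintype_card] using hm)
  refine ⟨(l.1.map f).prod⁻¹ * (l'.1.map f).prod, ?_, ?_⟩
  · rw [Ne, inv_mul_eq_one]
    exact fun h => hne (Subtype.ext (hf h))
  · exact inv_mul_mem_subtreeFixer (congrArg (fun z => z.1.1) hl) (congrArg (fun z => z.2.1) hl)

/-! ### Gluing by commutators -/

/-- If a free non-abelian group of automorphisms of `X*` contains, for each word `v` of a finite set
of words of length `n`, a nontrivial element acting trivially on the subtree of `v`, then one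
nontrivial element acts trivially on all these subtrees. -/
theorem exists_ne_one_forall_mem_subtreeFixer [Finite X] {H : Subgroup (TreeAut X)} [IsFreeGroup H]
    (hH : ∃ a b : H, ¬ Commute a b) {n : ℕ} {S : Set (List X)} (hS : S.Finite)
    (hlen : ∀ v ∈ S, v.length = n)
    (h : ∀ v ∈ S, ∃ g : H, g ≠ 1 ∧ (g : TreeAut X) ∈ subtreeFixer v) :
    ∃ g : H, g ≠ 1 ∧ ∀ v ∈ S, (g : TreeAut X) ∈ subtreeFixer v := by
  have := IsFreeGroup.isMulTorsionFree H
  obtain ⟨p, hp, hfix⟩ := exists_pow_fix_level (X := X) n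
  have hpow : ∀ g : H, g ≠ 1 → g ^ p ≠ 1 := fun g hg => by rwa [Ne, pow_eq_one_iff_left hp]
  -- the induction keeps the element in the stabilizer of the level
  suffices ∃ g : H, g ≠ 1 ∧ (∀ v : List X, v.length = n → (g : TreeAut X) v = v) ∧
      ∀ v ∈ S, (g : TreeAut X) ∈ subtreeFixer v by
    obtain ⟨g, hg, -, hgS⟩ := this
    exact ⟨g, hg, hgS⟩
  induction S, hS using Set.Finite.induction_on with
  | empty =>
    obtain ⟨a, b, hab⟩ := hH
    refine ⟨a ^ p, hpow a ?_, fun v hv => hfix a v hv, by simp⟩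
    rintro rfl
    exact hab (Commute.one_left b)
  | @insert w S hw hS ih =>
    obtain ⟨x, hx, hxn, hxS⟩ := ih (fun v hv => hlen v (Or.inr hv)) fun v hv => h v (Or.inr hv)
    obtain ⟨y, hy, hyw⟩ := h w (Or.inl rfl)
    obtain ⟨g, hg⟩ := IsFreeGroup.exists_not_commute_conj_pow hH hx (hpow y hy) hp
    have hzw : ((g ^ p * y ^ p * (g ^ p)⁻¹ : H) : TreeAut X) ∈ subtreeFixer w :=
      conj_mem_subtreeFixer (pow_mem hyw p) (hfix g w (hlen w (Or.inl rfl)))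
    have hzn : ∀ v : List X, v.length = n →
        ((g ^ p * y ^ p * (g ^ p)⁻¹ : H) : TreeAut X) v = v := fun v hv => by
      have hgi : ((g : TreeAut X) ^ p)⁻¹ v = v := by
        rw [← inv_pow]
        exact hfix _ v hv
      change ((g : TreeAut X) ^ p) (((y : TreeAut X) ^ p) (((g : TreeAut X) ^ p)⁻¹ v)) = v
      rw [hgi, hfix _ v hv, hfix _ v hv]
    generalize g ^ p * y ^ p * (g ^ p)⁻¹ = z at hg hzw hzn
    have hinv : ∀ g : H, (∀ v : List X, v.length = n → (g : TreeAut X) v = v) →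
        ∀ v : List X, v.length = n → ((g⁻¹ : H) : TreeAut X) v = v := fun g hg v hv => by
      conv_lhs => rw [← hg v hv]
      exact inv_apply_self _ v
    refine ⟨x * z * x⁻¹ * z⁻¹, ?_, fun v hv => ?_, ?_⟩
    · rw [Ne, mul_inv_eq_one, mul_inv_eq_iff_eq_mul]
      exact hg
    · change (x : TreeAut X) ((z : TreeAut X) (((x⁻¹ : H) : TreeAut X)
        (((z⁻¹ : H) : TreeAut X) v))) = v
      rw [hinv z hzn v hv, hinv x hxn v hv, hzn v hv, hxn v hv]
    · rintro v (rfl | hv)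
      · exact mul_mem (conj_mem_subtreeFixer hzw (hxn _ (hlen _ (Or.inl rfl)))) (inv_mem hzw)
      · have hmem := mul_mem (hxS v hv) (conj_mem_subtreeFixer (inv_mem (hxS v hv))
          (hzn v (hlen v (Or.inr hv))))
        simpa [mul_assoc] using hmem

end TreeAut

/-- Contracting self-similar groups of automorphisms of the tree `X*` over a finite alphabet `X`
have no free non-abelian subgroups. -/
theorem theorem4p3 {X : Type*} [Finite X] (G : Subgroup (TreeAut X)) (hG : IsContracting G) :
    ¬ ∃ H : Subgroup (TreeAut X), H ≤ G ∧ IsFreeGroup H ∧ ∃ a ∈ H, ∃ b ∈ H, a * b ≠ b * a := by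
  rintro ⟨H, hHG, hfree, a, ha, b, hb, hab⟩
  have hH : ∃ a b : H, ¬ Commute a b :=
    ⟨⟨a, ha⟩, ⟨b, hb⟩, fun h => hab (congrArg Subtype.val h.eq)⟩
  obtain ⟨f, hf⟩ := IsFreeGroup.exists_injective_prod hH
  obtain ⟨n, hn⟩ := TreeAut.exists_ne_one_restrict_eq_one hG hHG f hf
  obtain ⟨g, hg, hgn⟩ := TreeAut.exists_ne_one_forall_mem_subtreeFixer hH
    (List.finite_length_eq X n) (fun v hv => hv) hn
  exact hg (Subtype.ext (TreeAut.eq_one_of_forall_mem_subtreeFixer hgn))
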